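/- Let $E$ be a separable (real) Banach space and let $A:D(A)\to E$ be a densely defined linear operator such that $-A$ is the infinitesimal generator of a $C_0$ semigroup $\{S_A(t)\}_{t\ge 0}$ of bounded linear operators on $E$ with $\|S_A(t)\|\le e^{-\omega t}$ for all $t\ge 0$, for some $\omega>0$. Let $T>0$ and let $F:[0,T]\times E\to E$ be continuous and such that: (i) for every $x\in E$ there are $\delta_x>0$, $L_x>0$ with $\|F(t,x_1)-F(t,x_2)\|\le L_x\|x_1-x_2\|$ for all $x_1,x_2\in B(x,\delta_x)$ and $t\in[0,T]$; (ii) there is $c>0$ with $\|F(t,x)\|\le c(1+\|x\|)$ for all $t\in[0,T]$, $x\in E$; (iii) there is $k\in[0,\omega)$ with $\beta(F([0,T]\times\Omega))\le k\,\beta(\Omega)$ for every bounded $\Omega\subset E$, where $\beta$ is the Hausdorff measure of noncompactness, i.e. $\beta(\Omega)$ is the infimum of all $r>0$ such that $\Omega$ can be covered by finitely many balls of $E$ of radius $r$. For $\lambda\ge 0$ consider $\dot u=-\lambda Au+\lambda F(t,u)$ on $[0,T]$. The mild solution of this equation with $u(0)=x$ is the (unique) continuous $u:[0,T]\to E$ with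 $$u(t)=S_A(\lambda t)x+\lambda\int_0^t S_A(\lambda(t-s))F(s,u(s))\,ds,\qquad t\in[0,T],$$ and $(x,\lambda)\in E\times[0,\infty)$ is called a $T$-periodic point if this solution satisfies $u(0)=u(T)$. Let $U\subset E$ be open and bounded, and let $x_0\in\overline U$ be a branching point, i.e. there is a sequence of $T$-periodic points $(x_n,\lambda_n)\in\overline U\times(0,\infty)$ converging to $(x_0,0)$. Then $x_0\in D(A)$ and $$-Ax_0+\widehat F(x_0)=0,\qquad\text{where}\quad \widehat F(x):=\frac1T\int_0^T F(t,x)\,dt .$$ -/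

import Mathlib

open Set Filter Topology MeasureTheory

noncomputable section

/-- `S` is a `C₀` semigroup of bounded linear operators on `E`. Only the operators `S t` with
`0 ≤ t` matter. -/
structure IsC0Semigroup {E : Type*} [NormedAddCommGroup E] [NormedSpace ℝ E]
    (S : ℝ → E →L[ℝ] E) : Prop where
  map_zero : S 0 = ContinuousLinearMap.id ℝ E
  map_add : ∀ s t : ℝ, 0 ≤ s → 0 ≤ t → S (s + t) = (S s).comp (S t)
  tendsto_zero : ∀ x : E, Tendsto (fun t : ℝ => S t x) (𝓝[>] 0) (𝓝 x)

/-- `B` is the infinitesimal generator of the `C₀` semigroup `S`: a point `x` lies in the domain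
of `B` and `B x = y` if and only if `(S t x - x) / t → y` as `t → 0⁺`. -/
structure IsInfinitesimalGenerator {E : Type*} [NormedAddCommGroup E] [NormedSpace ℝ E]
    (B : E →ₗ.[ℝ] E) (S : ℝ → E →L[ℝ] E) : Prop where
  semigroup : IsC0Semigroup S
  generator : ∀ x y : E, (∃ h : x ∈ B.domain, B ⟨x, h⟩ = y) ↔
    Tendsto (fun t : ℝ => t⁻¹ • (S t x - x)) (𝓝[>] 0) (𝓝 y)

/-- The Hausdorff measure of noncompactness: the infimum of all `r > 0` such that `Ω` can be
covered by finitely many balls of `E` of radius `r` (it is `∞` if `Ω` is unbounded). -/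
def hausdorffMNC {E : Type*} [NormedAddCommGroup E] (Ω : Set E) : ENNReal :=
  sInf (ENNReal.ofReal '' {r : ℝ | 0 < r ∧
    ∃ C : Set E, C.Finite ∧ Ω ⊆ ⋃ c ∈ C, Metric.ball c r})

/-- `u` is a mild solution on `[0, T]` of `u' = B u + f (t, u)`, `u 0 = x`, where `B` is the
generator of the `C₀` semigroup `S`. -/
structure IsMildSolution {E : Type*} [NormedAddCommGroup E] [NormedSpace ℝ E]
    (S : ℝ → E →L[ℝ] E) (f : ℝ → E → E) (T : ℝ) (x : E) (u : ℝ → E) : Prop where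
  continuousOn : ContinuousOn u (Icc 0 T)
  initial : u 0 = x
  duhamel : ∀ t ∈ Icc (0 : ℝ) T,
    u t = S t x + ∫ s in (0 : ℝ)..t, S (t - s) (f s (u s))

/-- The semigroup `t ↦ S (l t)`. If `-A` generates `S` and `0 < l`, then it is the semigroup
generated by `-l A` (see `scaledSemigroup_generator`); for `l = 0` it is the trivial semigroup. -/
def scaledSemigroup {E : Type*} [NormedAddCommGroup E] [NormedSpace ℝ E]
    (S : ℝ → E →L[ℝ] E) (l : ℝ) : ℝ → E →L[ℝ] E :=
  fun t => S (l * t)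

theorem scaledSemigroup_generator {E : Type*} [NormedAddCommGroup E] [NormedSpace ℝ E]
    {A : E →ₗ.[ℝ] E} {S : ℝ → E →L[ℝ] E} (h : IsInfinitesimalGenerator (-A) S)
    {l : ℝ} (hl : 0 < l) :
    IsInfinitesimalGenerator (-(l • A)) (scaledSemigroup S l) := by
  have hlim : Tendsto (fun t : ℝ => l * t) (𝓝[>] 0) (𝓝[>] 0) := by
    refine tendsto_nhdsWithin_iff.2 ⟨?_, ?_⟩
    · have : Tendsto (fun t : ℝ => l * t) (𝓝 0) (𝓝 (l * 0)) :=
        (continuous_const.mul continuous_id).tendsto 0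
      rw [mul_zero] at this
      exact this.mono_left nhdsWithin_le_nhds
    · filter_upwards [self_mem_nhdsWithin] with t ht
      exact mul_pos hl ht
  have hlim' : Tendsto (fun t : ℝ => l⁻¹ * t) (𝓝[>] 0) (𝓝[>] 0) := by
    refine tendsto_nhdsWithin_iff.2 ⟨?_, ?_⟩
    · have : Tendsto (fun t : ℝ => l⁻¹ * t) (𝓝 0) (𝓝 (l⁻¹ * 0)) :=
        (continuous_const.mul continuous_id).tendsto 0
      rw [mul_zero] at this
      exact this.mono_left nhdsWithin_le_nhds
    · filter_upwards [self_mem_nhdsWithin] with t ht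
      exact mul_pos (inv_pos.2 hl) ht
  refine ⟨⟨?_, ?_, ?_⟩, ?_⟩
  · simp [scaledSemigroup, h.semigroup.map_zero]
  · intro s t hs ht
    simp only [scaledSemigroup, mul_add]
    exact h.semigroup.map_add _ _ (by positivity) (by positivity)
  · intro x
    exact (h.semigroup.tendsto_zero x).comp hlim
  · intro x y
    have key : (∃ hx : x ∈ (-(l • A)).domain, (-(l • A)) ⟨x, hx⟩ = y) ↔
        (∃ hx : x ∈ (-A).domain, (-A) ⟨x, hx⟩ = l⁻¹ • y) := by
      constructor
      · rintro ⟨hx, hy⟩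
        refine ⟨hx, ?_⟩
        rw [← hy]
        change -(A ⟨x, hx⟩) = l⁻¹ • -(l • A ⟨x, hx⟩)
        rw [smul_neg, inv_smul_smul₀ hl.ne']
      · rintro ⟨hx, hy⟩
        refine ⟨hx, ?_⟩
        have hy' : -(A ⟨x, hx⟩) = l⁻¹ • y := hy
        change -(l • A ⟨x, hx⟩) = y
        rw [← smul_neg, hy', smul_inv_smul₀ hl.ne']
    rw [key, h.generator]
    constructor
    · intro H
      have H2 := (H.comp hlim).const_smul l
      rw [smul_inv_smul₀ hl.ne'] at H2
      refine H2.congr fun t => ?_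
      simp only [Function.comp, scaledSemigroup, smul_smul, mul_inv]
      rw [← mul_assoc, mul_inv_cancel₀ hl.ne', one_mul]
    · intro H
      have H2 := (H.comp hlim').const_smul l⁻¹
      refine H2.congr fun t => ?_
      simp only [Function.comp, scaledSemigroup, smul_smul, mul_inv, inv_inv]
      rw [← mul_assoc, ← mul_assoc, inv_mul_cancel₀ hl.ne', mul_inv_cancel₀ hl.ne', one_mul, one_mul]

/-- `(x, l)` is a `T`-periodic point of `u' = -l A u + l F (t, u)`, where `-A` generates `S`:
the mild solution starting at `x` is at `x` again at time `T`. -/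
def IsTPeriodicPoint {E : Type*} [NormedAddCommGroup E] [NormedSpace ℝ E]
    (S : ℝ → E →L[ℝ] E) (F : ℝ → E → E) (T : ℝ) (x : E) (l : ℝ) : Prop :=
  ∃ u : ℝ → E,
    IsMildSolution (scaledSemigroup S l) (fun t y => l • F t y) T x u ∧ u 0 = u T

/-- `x₀` is a branching point in `closure U`: it is a limit of points `xs n` of `closure U` such
that `(xs n, ls n)` is `T`-periodic for some `ls n > 0` with `ls n → 0`. -/
def IsBranchingPoint {E : Type*} [NormedAddCommGroup E] [NormedSpace ℝ E]
    (S : ℝ → E →L[ℝ] E) (F : ℝ → E → E) (T : ℝ) (U : Set E) (x₀ : E) : Prop :=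
  x₀ ∈ closure U ∧ ∃ (xs : ℕ → E) (ls : ℕ → ℝ),
    (∀ n, xs n ∈ closure U ∧ 0 < ls n ∧ IsTPeriodicPoint S F T (xs n) (ls n)) ∧
    Tendsto (fun n => (xs n, ls n)) atTop (𝓝 (x₀, 0))

/-- The time average `x ↦ (1 / T) ∫₀ᵀ F (t, x) dt`. -/
def timeAverage {E : Type*} [NormedAddCommGroup E] [NormedSpace ℝ E]
    (F : ℝ → E → E) (T : ℝ) (x : E) : E :=
  (1 / T) • ∫ t in (0 : ℝ)..T, F t x

end

/-! ### Contraction semigroups and difference quotients along moving base points. -/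

section ContractionSemigroup

variable {E : Type*} [NormedAddCommGroup E] [NormedSpace ℝ E] {S : ℝ → E →L[ℝ] E}

/-! Periodicity turns Duhamel's formula at time `T` into `S rₙ xₙ - xₙ = -rₙ zₙ` with `rₙ = lₙ T →
0`, where `zₙ` is `1 / T` times the Duhamel integral. As `lₙ → 0` the solutions flatten to the
constant `x₀`, so dominated convergence gives `zₙ → y`, the time average of `F` at `x₀`
(`tendsto_duhamel_integral`).

The base points `xₙ` move and need not lie in the domain of `A`. Iterating the relation `⌊τ / rₙ⌋`
times telescopes it into a Riemann sum over `[0, τ]`; letting `n → ∞` bounds `S τ x₀ - x₀ + τ y` by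
`τ sup ‖S s y - y‖` over `[0, τ]`. Dividing by `τ → 0⁺` gives `x₀ ∈ D(A)` and `-A x₀ = -y`
(`tendsto_of_tendsto_quotient`). -/

theorem IsC0Semigroup.tendsto_nhdsGE_zero (h : IsC0Semigroup S) (x : E) :
    Tendsto (fun t : ℝ => S t x) (𝓝[≥] 0) (𝓝 x) := by
  have h0 : ContinuousWithinAt (fun t : ℝ => S t x) (Ioi 0) 0 := by
    simpa [ContinuousWithinAt, h.map_zero] using h.tendsto_zero x
  simpa [ContinuousWithinAt, h.map_zero] using continuousWithinAt_Ioi_iff_Ici.1 h0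

theorem norm_apply_le_of_norm_le_one {L : E →L[ℝ] E} (hL : ‖L‖ ≤ 1) (x : E) : ‖L x‖ ≤ ‖x‖ := by
  simpa using L.le_of_opNorm_le hL x

/-- The semigroup law factors out `S (min a b)`, a contraction, leaving only the time gap `|a - b|`.
-/
theorem IsC0Semigroup.norm_sub_le (h : IsC0Semigroup S) (hS : ∀ t, 0 ≤ t → ‖S t‖ ≤ 1)
    {a b : ℝ} (ha : 0 ≤ a) (hb : 0 ≤ b) (v w : E) :
    ‖S a v - S b w‖ ≤ ‖v - w‖ + ‖S |a - b| w - w‖ := by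
  have key : ‖S a w - S b w‖ ≤ ‖S |a - b| w - w‖ := by
    have aux : ∀ {c d : ℝ}, 0 ≤ d → d ≤ c → ‖S c w - S d w‖ ≤ ‖S (c - d) w - w‖ := by
      intro c d hd hdc
      have hc : S c w = S d (S (c - d) w) := by
        have := h.map_add d (c - d) hd (sub_nonneg.2 hdc)
        rw [add_sub_cancel] at this
        rw [this, ContinuousLinearMap.comp_apply]
      rw [hc, ← map_sub]
      exact norm_apply_le_of_norm_le_one (hS d hd) _
    rcases le_total b a with hab | hab
    · rw [abs_of_nonneg (sub_nonneg.2 hab)]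
      exact aux hb hab
    · rw [abs_sub_comm, abs_of_nonneg (sub_nonneg.2 hab), norm_sub_rev]
      exact aux ha hab
  calc ‖S a v - S b w‖ = ‖S a (v - w) + (S a w - S b w)‖ := by rw [map_sub]; congr 1; abel
    _ ≤ ‖S a (v - w)‖ + ‖S a w - S b w‖ := norm_add_le _ _
    _ ≤ _ := add_le_add (norm_apply_le_of_norm_le_one (hS a ha) _) key

/-- A contraction semigroup is jointly continuous in time and space. -/
theorem IsC0Semigroup.tendsto_apply (h : IsC0Semigroup S) (hS : ∀ t, 0 ≤ t → ‖S t‖ ≤ 1)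
    {ι : Type*} {l : Filter ι} {a : ι → ℝ} {v : ι → E} {b : ℝ} {w : E}
    (ha : ∀ᶠ i in l, 0 ≤ a i) (hb : 0 ≤ b) (hab : Tendsto a l (𝓝 b)) (hvw : Tendsto v l (𝓝 w)) :
    Tendsto (fun i => S (a i) (v i)) l (𝓝 (S b w)) := by
  rw [tendsto_iff_norm_sub_tendsto_zero]
  have h1 : Tendsto (fun i => |a i - b|) l (𝓝[≥] 0) := by
    refine tendsto_nhdsWithin_iff.2 ⟨?_, Eventually.of_forall fun i => mem_Ici.2 (abs_nonneg _)⟩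
    simpa using (hab.sub_const b).abs
  have h2 := tendsto_iff_norm_sub_tendsto_zero.1 ((h.tendsto_nhdsGE_zero w).comp h1)
  have h3 := (tendsto_iff_norm_sub_tendsto_zero.1 hvw).add h2
  rw [add_zero] at h3
  refine squeeze_zero' (Eventually.of_forall fun _ => norm_nonneg _) ?_ h3
  filter_upwards [ha] with i hi
  exact h.norm_sub_le hS hi hb _ _

/-- Telescoping gives `S (m r) x - x = -r ∑_{j<m} S (j r) z`. Each summand differs from `y` by `S (j
r) (z - y) + (S (j r) y - y)`, of norm at most `η + ε`. -/
theorem IsC0Semigroup.norm_iterate_sub_add_le (h : IsC0Semigroup S)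
    (hS : ∀ t, 0 ≤ t → ‖S t‖ ≤ 1) {τ r ε η : ℝ} (hr : 0 ≤ r) {x y z : E}
    (hz : S r x - x = -(r • z)) (hzy : ‖z - y‖ ≤ η)
    (hy : ∀ s, 0 ≤ s → s ≤ τ → ‖S s y - y‖ ≤ ε) (m : ℕ) (hm : m * r ≤ τ) :
    ‖S (m * r) x - x + (m * r) • y‖ ≤ m * r * (ε + η) := by
  induction m with
  | zero => simp [h.map_zero]
  | succ m ih =>
    have hmr : 0 ≤ (m : ℝ) * r := by positivity
    push_cast at hm ⊢
    rw [add_mul, one_mul] at hm ⊢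
    have hm' : (m : ℝ) * r ≤ τ := by linarith
    have hsplit : S (m * r + r) x - x + (m * r + r) • y =
        (S (m * r) x - x + (m * r) • y) + (-r) • (S (m * r) (z - y) + (S (m * r) y - y)) := by
      have hx : S r x = x - r • z := by
        rw [sub_eq_iff_eq_add.1 hz, neg_add_eq_sub]
      rw [h.map_add _ _ hmr hr, ContinuousLinearMap.comp_apply, hx]
      simp only [map_sub, map_smul]
      module
    have h1 : ‖S (m * r) (z - y) + (S (m * r) y - y)‖ ≤ ε + η := by
      have h2 := norm_add_le (S (m * r) (z - y)) (S (m * r) y - y)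
      have h3 := norm_apply_le_of_norm_le_one (hS _ hmr) (z - y)
      have h4 := hy _ hmr hm'
      linarith
    calc _ ≤ ‖S (m * r) x - x + (m * r) • y‖ +
          ‖(-r) • (S (m * r) (z - y) + (S (m * r) y - y))‖ := by
            rw [hsplit]; exact norm_add_le _ _
      _ ≤ m * r * (ε + η) + r * (ε + η) := by
            rw [norm_smul, norm_neg, Real.norm_of_nonneg hr]
            exact add_le_add (ih hm') (mul_le_mul_of_nonneg_left h1 hr)
      _ = (m * r + r) * (ε + η) := by ring

/-- If `xₙ → x`, `rₙ → 0⁺` and the difference quotients `(xₙ - S rₙ xₙ) / rₙ` converge to `y`, then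
the semigroup is differentiable at `0` along `x` with derivative `-y`. -/
theorem IsC0Semigroup.tendsto_of_tendsto_quotient (h : IsC0Semigroup S)
    (hS : ∀ t, 0 ≤ t → ‖S t‖ ≤ 1) {r : ℕ → ℝ} {x z : ℕ → E} {x₀ y : E}
    (hr : ∀ n, 0 < r n) (hr0 : Tendsto r atTop (𝓝 0)) (hx : Tendsto x atTop (𝓝 x₀))
    (hz : ∀ n, S (r n) (x n) - x n = -(r n • z n)) (hzy : Tendsto z atTop (𝓝 y)) :
    Tendsto (fun t : ℝ => t⁻¹ • (S t x₀ - x₀)) (𝓝[>] 0) (𝓝 (-y)) := by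
  have bound : ∀ ε τ : ℝ, 0 < τ → (∀ s, 0 ≤ s → s ≤ τ → ‖S s y - y‖ ≤ ε) →
      ‖S τ x₀ - x₀ + τ • y‖ ≤ τ * ε := by
    intro ε τ hτ hε
    -- Rounding down keeps the total time `⌊τ / rₙ⌋ rₙ` within `[0, τ]`, where `hε` applies, while
    -- missing `τ` by less than `rₙ`.
    have hfloor : Tendsto (fun n => (⌊τ / r n⌋₊ : ℝ) * r n) atTop (𝓝 τ) := by
      refine tendsto_of_tendsto_of_tendsto_of_le_of_le (g := fun n => τ - r n) (h := fun _ => τ)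
        (by simpa using hr0.const_sub τ) tendsto_const_nhds (fun n => ?_) (fun n => ?_)
      · have := Nat.lt_floor_add_one (τ / r n)
        rw [div_lt_iff₀ (hr n)] at this
        dsimp only
        linarith
      · exact (le_div_iff₀ (hr n)).1 (Nat.floor_le (div_nonneg hτ.le (hr n).le))
    have hle : ∀ n, (⌊τ / r n⌋₊ : ℝ) * r n ≤ τ := fun n =>
      (le_div_iff₀ (hr n)).1 (Nat.floor_le (div_nonneg hτ.le (hr n).le))
    have hlim := h.tendsto_apply hS
      (Eventually.of_forall fun n => mul_nonneg (Nat.cast_nonneg ⌊τ / r n⌋₊) (hr n).le)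
      hτ.le hfloor hx
    have hη := tendsto_iff_norm_sub_tendsto_zero.1 hzy
    have hR := hfloor.mul (hη.const_add ε)
    rw [add_zero] at hR
    exact le_of_tendsto_of_tendsto' ((hlim.sub hx).add (hfloor.smul_const y)).norm hR fun n =>
      h.norm_iterate_sub_add_le hS (hr n).le (hz n) le_rfl hε _ (hle n)
  rw [Metric.tendsto_nhds]
  intro ε hε
  have h1 : ∀ᶠ s in 𝓝[≥] (0 : ℝ), ‖S s y - y‖ < ε / 2 := by
    simpa [dist_eq_norm] using Metric.tendsto_nhds.1 (h.tendsto_nhdsGE_zero y) (ε / 2) (half_pos hε)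
  obtain ⟨δ, hδ, hsub⟩ := mem_nhdsGE_iff_exists_Ico_subset.1 h1
  filter_upwards [Ioo_mem_nhdsGT (mem_Ioi.1 hδ)] with t ht
  have h2 := bound (ε / 2) t ht.1 fun s hs hst => (hsub ⟨hs, hst.trans_lt ht.2⟩ : _ < _).le
  have h3 : t⁻¹ • (S t x₀ - x₀) - -y = t⁻¹ • (S t x₀ - x₀ + t • y) := by
    rw [smul_add, inv_smul_smul₀ ht.1.ne', sub_neg_eq_add]
  rw [dist_eq_norm, h3, norm_smul, Real.norm_of_nonneg (inv_nonneg.2 ht.1.le)]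
  calc t⁻¹ * ‖S t x₀ - x₀ + t • y‖ ≤ t⁻¹ * (t * (ε / 2)) :=
        mul_le_mul_of_nonneg_left h2 (inv_nonneg.2 ht.1.le)
    _ = ε / 2 := by rw [inv_mul_cancel_left₀ ht.1.ne']
    _ < ε := half_lt_self hε

end ContractionSemigroup

/-! ### Mild solutions for small parameters. -/

section MildSolution

variable {E : Type*} [NormedAddCommGroup E] [NormedSpace ℝ E] {S : ℝ → E →L[ℝ] E}
  {F : ℝ → E → E} {T : ℝ}

theorem scaledSemigroup_duhamel_integral_eq (l t : ℝ) (u : ℝ → E) :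
    ∫ s in (0 : ℝ)..t, scaledSemigroup S l (t - s) (l • F s (u s)) =
      l • ∫ s in (0 : ℝ)..t, S (l * (t - s)) (F s (u s)) := by
  simp only [scaledSemigroup, map_smul, intervalIntegral.integral_smul]

theorem IsMildSolution.norm_sub_semigroup_le {l c : ℝ} {x : E} {u : ℝ → E}
    (hu : IsMildSolution (scaledSemigroup S l) (fun t y => l • F t y) T x u)
    (hS : ∀ t, 0 ≤ t → ‖S t‖ ≤ 1) (hl : 0 < l) (hc : 0 < c)
    (hF : ∀ t ∈ Icc (0 : ℝ) T, ∀ x : E, ‖F t x‖ ≤ c * (1 + ‖x‖))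
    {M t : ℝ} (hM : ∀ s ∈ Icc 0 T, ‖u s‖ ≤ M) (ht : t ∈ Icc 0 T) :
    ‖u t - S (l * t) x‖ ≤ l * (c * (1 + M) * T) := by
  have hM0 : 0 ≤ M := (norm_nonneg _).trans (hM t ht)
  have h1 : ‖∫ s in (0 : ℝ)..t, S (l * (t - s)) (F s (u s))‖ ≤ c * (1 + M) * |t - 0| := by
    refine intervalIntegral.norm_integral_le_of_norm_le_const fun s hs => ?_
    rw [uIoc_of_le ht.1] at hs
    have hsT : s ∈ Icc 0 T := ⟨hs.1.le, hs.2.trans ht.2⟩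
    refine (norm_apply_le_of_norm_le_one (hS _ (mul_nonneg hl.le (sub_nonneg.2 hs.2))) _).trans
      ((hF s hsT _).trans ?_)
    have := hM s hsT
    gcongr
  rw [hu.duhamel t ht, scaledSemigroup_duhamel_integral_eq, scaledSemigroup, add_sub_cancel_left,
    norm_smul, Real.norm_of_nonneg hl.le]
  rw [sub_zero, abs_of_nonneg ht.1] at h1
  refine mul_le_mul_of_nonneg_left (h1.trans ?_) hl.le
  have := ht.2
  gcongr

/-- Absorption replaces Grönwall: for small `l` the maximum `m` of `‖u‖` satisfies `m ≤ ‖x‖ + (1 +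
m) / 2`. -/
theorem IsMildSolution.norm_le {l c : ℝ} {x : E} {u : ℝ → E}
    (hu : IsMildSolution (scaledSemigroup S l) (fun t y => l • F t y) T x u)
    (hS : ∀ t, 0 ≤ t → ‖S t‖ ≤ 1) (hl : 0 < l) (hc : 0 < c) (hT : 0 < T)
    (hF : ∀ t ∈ Icc (0 : ℝ) T, ∀ x : E, ‖F t x‖ ≤ c * (1 + ‖x‖)) (hlc : l * (c * T) ≤ 1 / 2) :
    ∀ t ∈ Icc 0 T, ‖u t‖ ≤ 2 * ‖x‖ + 1 := by
  obtain ⟨t₀, ht₀, hmax⟩ := isCompact_Icc.exists_isMaxOn (nonempty_Icc.2 hT.le) hu.continuousOn.norm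
  have hM : ∀ s ∈ Icc 0 T, ‖u s‖ ≤ ‖u t₀‖ := fun s hs => hmax hs
  have h1 := hu.norm_sub_semigroup_le hS hl hc hF hM ht₀
  have h2 := norm_apply_le_of_norm_le_one (hS _ (mul_nonneg hl.le ht₀.1)) x
  have h3 := norm_le_norm_add_norm_sub' (u t₀) (S (l * t₀) x)
  have h4 : l * (c * (1 + ‖u t₀‖) * T) ≤ 1 / 2 * (1 + ‖u t₀‖) := by
    calc _ = l * (c * T) * (1 + ‖u t₀‖) := by ring
      _ ≤ _ := mul_le_mul_of_nonneg_right hlc (by positivity)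
  intro t ht
  linarith [hM t ht]

/-- Mild solutions starting at `xₙ → x₀` with parameters `lₙ → 0⁺` are eventually uniformly
bounded, and converge pointwise to `x₀`. -/
theorem tendsto_mildSolution (h : IsC0Semigroup S) (hS : ∀ t, 0 ≤ t → ‖S t‖ ≤ 1) (hT : 0 < T)
    {c : ℝ} (hc : 0 < c) (hF : ∀ t ∈ Icc (0 : ℝ) T, ∀ x : E, ‖F t x‖ ≤ c * (1 + ‖x‖))
    {l : ℕ → ℝ} {x : ℕ → E} {u : ℕ → ℝ → E} {x₀ : E} (hl : ∀ n, 0 < l n)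
    (hl0 : Tendsto l atTop (𝓝 0)) (hx : Tendsto x atTop (𝓝 x₀))
    (hu : ∀ n, IsMildSolution (scaledSemigroup S (l n)) (fun t y => l n • F t y) T (x n) (u n)) :
    ∃ M : ℝ, (∀ᶠ n in atTop, ∀ t ∈ Icc 0 T, ‖u n t‖ ≤ M) ∧
      ∀ t ∈ Icc 0 T, Tendsto (fun n => u n t) atTop (𝓝 x₀) := by
  have hM : ∀ᶠ n in atTop, ∀ t ∈ Icc 0 T, ‖u n t‖ ≤ 2 * (‖x₀‖ + 1) + 1 := by
    have h1 : ∀ᶠ n in atTop, l n * (c * T) < 1 / 2 := by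
      have := hl0.mul_const (c * T)
      rw [zero_mul] at this
      exact this.eventually_lt_const (by norm_num)
    have h2 : ∀ᶠ n in atTop, ‖x n‖ < ‖x₀‖ + 1 := hx.norm.eventually_lt_const (lt_add_one _)
    filter_upwards [h1, h2] with n hn1 hn2 t ht
    linarith [(hu n).norm_le hS (hl n) hc hT hF hn1.le t ht]
  refine ⟨_, hM, fun t ht => ?_⟩
  have h1 : Tendsto (fun n => S (l n * t) (x n)) atTop (𝓝 x₀) := by
    have := h.tendsto_apply hS (a := fun n => l n * t) (b := 0)
      (Eventually.of_forall fun n => mul_nonneg (hl n).le ht.1) le_rfl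
      (by simpa using hl0.mul_const t) hx
    simpa [h.map_zero] using this
  have h2 : Tendsto (fun n => u n t - S (l n * t) (x n)) atTop (𝓝 0) := by
    refine squeeze_zero_norm' ?_ (by simpa using hl0.mul_const (c * (1 + (2 * (‖x₀‖ + 1) + 1)) * T))
    filter_upwards [hM] with n hn
    exact (hu n).norm_sub_semigroup_le hS (hl n) hc hF hn ht
  simpa using h1.add h2

/-- Supplies the measurability needed for dominated convergence. -/
theorem continuousOn_duhamel_integrand (h : IsC0Semigroup S) (hS : ∀ t, 0 ≤ t → ‖S t‖ ≤ 1)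
    (hFcont : ContinuousOn (fun p : ℝ × E => F p.1 p.2) (Icc 0 T ×ˢ univ))
    {l : ℝ} (hl : 0 ≤ l) {u : ℝ → E} (hu : ContinuousOn u (Icc 0 T)) :
    ContinuousOn (fun s => S (l * (T - s)) (F s (u s))) (Icc 0 T) := by
  have hFu : ContinuousOn (fun s => F s (u s)) (Icc 0 T) :=
    hFcont.comp (f := fun s => (s, u s)) (continuousOn_id.prodMk hu) fun s hs => ⟨hs, mem_univ _⟩
  intro s hs
  refine h.tendsto_apply hS ?_ (mul_nonneg hl (sub_nonneg.2 hs.2)) ?_ (hFu s hs)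
  · filter_upwards [self_mem_nhdsWithin] with r hr
    exact mul_nonneg hl (sub_nonneg.2 hr.2)
  · exact (Continuous.tendsto (by fun_prop) s).mono_left nhdsWithin_le_nhds

/-- The Duhamel integrals of the mild solutions converge to the integral of `F` at the limit. -/
theorem tendsto_duhamel_integral (h : IsC0Semigroup S) (hS : ∀ t, 0 ≤ t → ‖S t‖ ≤ 1) (hT : 0 < T)
    (hFcont : ContinuousOn (fun p : ℝ × E => F p.1 p.2) (Icc 0 T ×ˢ univ))
    {c : ℝ} (hc : 0 < c) (hF : ∀ t ∈ Icc (0 : ℝ) T, ∀ x : E, ‖F t x‖ ≤ c * (1 + ‖x‖))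
    {l : ℕ → ℝ} {x : ℕ → E} {u : ℕ → ℝ → E} {x₀ : E} (hl : ∀ n, 0 < l n)
    (hl0 : Tendsto l atTop (𝓝 0)) (hx : Tendsto x atTop (𝓝 x₀))
    (hu : ∀ n, IsMildSolution (scaledSemigroup S (l n)) (fun t y => l n • F t y) T (x n) (u n)) :
    Tendsto (fun n => ∫ s in (0 : ℝ)..T, S (l n * (T - s)) (F s (u n s))) atTop
      (𝓝 (∫ s in (0 : ℝ)..T, F s x₀)) := by
  obtain ⟨M, hM, hlim⟩ := tendsto_mildSolution h hS hT hc hF hl hl0 hx hu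
  have hsub : uIoc (0 : ℝ) T ⊆ Icc 0 T := by
    rw [uIoc_of_le hT.le]
    exact Ioc_subset_Icc_self
  refine intervalIntegral.tendsto_integral_filter_of_dominated_convergence
    (fun _ => c * (1 + M)) ?_ ?_ intervalIntegrable_const ?_
  · refine Eventually.of_forall fun n => ?_
    exact ((continuousOn_duhamel_integrand h hS hFcont (hl n).le
      (hu n).continuousOn).aestronglyMeasurable_of_isCompact isCompact_Icc
        measurableSet_Icc).mono_set hsub
  · filter_upwards [hM] with n hn
    refine Eventually.of_forall fun s hs => ?_
    have hs' := hsub hs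
    refine (norm_apply_le_of_norm_le_one
      (hS _ (mul_nonneg (hl n).le (sub_nonneg.2 hs'.2))) _).trans ((hF s hs' _).trans ?_)
    have := hn s hs'
    gcongr
  · refine Eventually.of_forall fun s hs => ?_
    have hs' := hsub hs
    -- Pointwise convergence of `u n s` and continuity of `F` at `(s, x₀)` suffice, since the
    -- majorant is constant.
    have h1 : Tendsto (fun n => F s (u n s)) atTop (𝓝 (F s x₀)) := by
      have h2 : Tendsto (fun n => (s, u n s)) atTop (𝓝[Icc 0 T ×ˢ univ] (s, x₀)) :=
        tendsto_nhdsWithin_iff.2 ⟨tendsto_const_nhds.prodMk_nhds (hlim s hs'),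
          Eventually.of_forall fun n => ⟨hs', mem_univ _⟩⟩
      exact (hFcont (s, x₀) ⟨hs', mem_univ _⟩).tendsto.comp h2
    have := h.tendsto_apply hS (a := fun n => l n * (T - s)) (b := 0)
      (Eventually.of_forall fun n => mul_nonneg (hl n).le (sub_nonneg.2 hs'.2)) le_rfl
      (by simpa using hl0.mul_const (T - s)) h1
    simpa [h.map_zero] using this

end MildSolution

/-! ### The branching point theorem. -/

theorem mainTheorem8 {E : Type*} [NormedAddCommGroup E] [NormedSpace ℝ E] [CompleteSpace E]
    [TopologicalSpace.SeparableSpace E]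
    (A : E →ₗ.[ℝ] E) (hA : Dense (A.domain : Set E))
    (S : ℝ → E →L[ℝ] E) (hAS : IsInfinitesimalGenerator (-A) S)
    (ω : ℝ) (hω : 0 < ω) (hS : ∀ t : ℝ, 0 ≤ t → ‖S t‖ ≤ Real.exp (-ω * t))
    (T : ℝ) (hT : 0 < T)
    (F : ℝ → E → E)
    (hFcont : ContinuousOn (fun p : ℝ × E => F p.1 p.2) (Icc 0 T ×ˢ univ))
    (hFlip : ∀ x : E, ∃ δ > 0, ∃ L > 0, ∀ x₁ ∈ Metric.ball x δ, ∀ x₂ ∈ Metric.ball x δ,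
      ∀ t ∈ Icc (0 : ℝ) T, ‖F t x₁ - F t x₂‖ ≤ L * ‖x₁ - x₂‖)
    (hFgrowth : ∃ c > 0, ∀ t ∈ Icc (0 : ℝ) T, ∀ x : E, ‖F t x‖ ≤ c * (1 + ‖x‖))
    (hFk : ∃ k : ℝ, 0 ≤ k ∧ k < ω ∧ ∀ Ω : Set E, Bornology.IsBounded Ω →
      hausdorffMNC ((fun p : ℝ × E => F p.1 p.2) '' (Icc 0 T ×ˢ Ω)) ≤
        ENNReal.ofReal k * hausdorffMNC Ω)
    (U : Set E) (hUopen : IsOpen U) (hUbdd : Bornology.IsBounded U)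
    (x₀ : E) (hx₀ : IsBranchingPoint S F T U x₀) :
    ∃ h : x₀ ∈ A.domain, -(A ⟨x₀, h⟩) + timeAverage F T x₀ = 0 := by

  obtain ⟨c, hc, hF⟩ := hFgrowth
  obtain ⟨-, xs, ls, hper, hlim⟩ := hx₀
  have hS1 : ∀ t, 0 ≤ t → ‖S t‖ ≤ 1 := fun t ht =>
    (hS t ht).trans (Real.exp_le_one_iff.2 (by nlinarith [mul_nonneg hω.le ht]))
  have hxs : Tendsto xs atTop (𝓝 x₀) := (continuous_fst.tendsto (x₀, (0 : ℝ))).comp hlim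
  have hls : Tendsto ls atTop (𝓝 0) := (continuous_snd.tendsto (x₀, (0 : ℝ))).comp hlim
  have hpos : ∀ n, 0 < ls n := fun n => (hper n).2.1
  choose u hu hclosed using fun n => (hper n).2.2
  have hint := tendsto_duhamel_integral hAS.semigroup hS1 hT hFcont hc hF hpos hls hxs hu
  -- Since `u n T = xs n`, Duhamel's formula at `T` is a difference relation with step `ls n * T`;
  -- the factor `T` in the step is offset by `1 / T`, which makes the limit an average.
  have hquot : ∀ n, S (ls n * T) (xs n) - xs n = -((ls n * T) •
      ((1 / T) • ∫ s in (0 : ℝ)..T, S (ls n * (T - s)) (F s (u n s)))) := by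
    intro n
    have h1 := (hu n).duhamel T ⟨hT.le, le_rfl⟩
    rw [← hclosed n, (hu n).initial, scaledSemigroup_duhamel_integral_eq, scaledSemigroup] at h1
    rw [smul_smul, mul_assoc, mul_one_div_cancel hT.ne', mul_one, sub_eq_iff_eq_add',
      ← sub_eq_add_neg]
    exact eq_sub_of_add_eq h1.symm
  have hgen := hAS.semigroup.tendsto_of_tendsto_quotient hS1 (fun n => mul_pos (hpos n) hT)
    (by simpa using hls.mul_const T) hxs hquot (hint.const_smul (1 / T))
  obtain ⟨hdom, hval⟩ := (hAS.generator x₀ _).2 hgen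
  have hval' : -(A ⟨x₀, hdom⟩) = -timeAverage F T x₀ := hval
  exact ⟨hdom, by rw [hval', neg_add_cancel]⟩
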